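/- Let $\mathbb F$ be a finite field with $q$ elements. For $n\ge 0$ equip $\mathbb F^{2n}=\mathbb F^n\oplus\mathbb F^n$ with the standard symplectic form $\omega((x,y),(x',y'))=x\cdot y'-y\cdot x'$, let $\mathrm{LGr}(2n)$ be the set of its Lagrangian subspaces (subspaces $L$ with $L=L^\perp$), and let $L_n=|\mathrm{LGr}(2n)|$. For $0\le m\le n$ let $E^m\oplus F^m\subset\mathbb F^n\oplus\mathbb F^n$ be the sum of the subspaces spanned by the first $m$ coordinates of $\mathbb F^n\oplus 0$ and of $0\oplus\mathbb F^n$, respectively, and let $$J_{n,m}=\bigl|\{L\in\mathrm{LGr}(2n) : \dim L\cap(E^m\oplus F^m)=\max\{0,2m-n\}\}\bigr|$$ (so that $J_{n,m}$ counts the $L$ with $L\cap(E^m\oplus F^m)=0$ if $2m\le n$). Let $l$ and $j$ be fixed integers with $0\le j\le l$. 1. If $2j\ne l$ then $$0\le 1-\frac{J_{Nl,Nj}}{L_{Nl}}\le\frac{q^{-1}+|\log(1-q^{-1})|}{1-q^{-1}}\cdot q^{-|l-2j|N}\qquad\text{for all }N\in\mathbb N.$$ 2. Assume $2j\le l$,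 and for any given real $\epsilon>0$ put $$T_N=\bigl|\{L\in\mathrm{LGr}(2Nl) : \dim L\cap(E^{Nj}\oplus F^{Nj})\ge N\epsilon\}\bigr|.$$ Then $$\frac{T_N}{L_{Nl}}\le e^{\frac{2q}{q-1}|\log(1-q^{-1})|}\cdot\frac{(q^2-1)^2}{(q^2-1)^2-q}\cdot q^{-N^2\epsilon^2}\qquad\text{for all }N\in\mathbb N.$$ -/

import Mathlib

/-- The vector space `F^{2n} = F^n ⊕ F^n`. -/
abbrev SympSpace (F : Type*) (n : ℕ) : Type _ := (Fin n → F) × (Fin n → F)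

/-- The standard symplectic form `ω((x, y), (x', y')) = x · y' - y · x'` on `F^n ⊕ F^n`. -/
def sympForm (F : Type*) [Field F] (n : ℕ) : LinearMap.BilinForm F (SympSpace F n) :=
  LinearMap.mk₂ F (fun v w => v.1 ⬝ᵥ w.2 - v.2 ⬝ᵥ w.1)
    (fun v v' w => by simp only [Prod.fst_add, Prod.snd_add, add_dotProduct]; ring)
    (fun c v w => by simp only [Prod.smul_fst, Prod.smul_snd, smul_dotProduct, smul_eq_mul]; ring)
    (fun v w w' => by simp only [Prod.fst_add, Prod.snd_add, dotProduct_add]; ring)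
    (fun c v w => by simp only [Prod.smul_fst, Prod.smul_snd, dotProduct_smul, smul_eq_mul]; ring)

/-- The Lagrangian Grassmannian of `F^{2n}`: the set of all linear subspaces that are equal to
their own orthogonal complement with respect to the symplectic form. -/
def lagrangians (F : Type*) [Field F] (n : ℕ) : Set (Submodule F (SympSpace F n)) :=
  {L | (sympForm F n).orthogonal L = L}

/-- The subspace of `F^n` spanned by the first `m` standard basis vectors. -/
def firstCoords (F : Type*) [Field F] (n m : ℕ) : Submodule F (Fin n → F) :=
  Submodule.span F {v | ∃ i : Fin n, (i : ℕ) < m ∧ v = Pi.single i 1}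

/-- The subspace `E^m ⊕ F^m` of `F^n ⊕ F^n`, spanned by the first `m` coordinates of each of the
two summands. -/
def coordSubspace (F : Type*) [Field F] (n m : ℕ) : Submodule F (SympSpace F n) :=
  (firstCoords F n m).prod (firstCoords F n m)

/-- The number `L_n` of Lagrangian subspaces of `F^{2n}`. -/
noncomputable def numLagrangians (F : Type*) [Field F] (n : ℕ) : ℕ :=
  (lagrangians F n).ncard

/-- The number `M_{n,m,s}` of Lagrangian subspaces of `F^{2n}` whose intersection with
`E^m ⊕ F^m` has dimension `s`. -/
noncomputable def numInter (F : Type*) [Field F] (n m s : ℕ) : ℕ :=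
  {L ∈ lagrangians F n |
    Module.finrank F (L ⊓ coordSubspace F n m : Submodule F (SympSpace F n)) = s}.ncard

/-- The number `J_{n,m}` of Lagrangian subspaces of `F^{2n}` in general position with respect to
`E^m ⊕ F^m`: the intersection is zero if `2m ≤ n`, and has dimension `2m - n` if `2m ≥ n`. -/
noncomputable def numGeneric (F : Type*) [Field F] (n m : ℕ) : ℕ :=
  if 2 * m ≤ n then {L ∈ lagrangians F n | L ⊓ coordSubspace F n m = ⊥}.ncard
  else numInter F n m (2 * m - n)

/-- The number of Lagrangian subspaces of `F^{2n}` whose intersection with `E^m ⊕ F^m` has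
dimension at least the real number `t`. -/
noncomputable def numInterGe (F : Type*) [Field F] (n m : ℕ) (t : ℝ) : ℕ :=
  {L ∈ lagrangians F n |
    t ≤ (Module.finrank F (L ⊓ coordSubspace F n m : Submodule F (SympSpace F n)) : ℝ)}.ncard

/-! ### Alternating forms: isotropic and Lagrangian subspaces, transvections, Witt transitivity. -/

section Symplectic

open Module LinearMap.BilinForm

variable {F V : Type*} [Field F] [AddCommGroup V] [Module F V]
  {B : LinearMap.BilinForm F V}

/-! Both bounds come from one double count. Let `W` be a nondegenerate subspace of a symplectic
space of dimension `2n` over a field with `q` elements, and count pairs of a Lagrangian `L` and a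
linearly independent `s`-tuple in `L ∩ W`. An `L` with `dim (L ∩ W) ≥ s` contributes at least
`|GL_s(q)|` pairs.

Conversely, build the tuple one vector at a time, with isotropic span `U` of dimension `k`. At most
`q ^ (dim W - k)` vectors of `W` extend it, by nondegeneracy of `W`. Each extension divides the
number of Lagrangians above the span by at least `q ^ (n - k)`, since by Witt transitivity
(`exists_isometry_fixing`) that number does not depend on the added vector. The powers of `q ^ k`
cancel, so the proportion of such `L` is at most `q ^ (s (dim W - n)) / |GL_s(q)|`
(`card_lagrangians_finrank_inf_ge_mul_le`).

Part 1 is `s = 1`, with `W` either `E^m ⊕ F^m` or its complement; part 2 is `s = ⌈Nε⌉` with `dim W ≤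
n`, and a lower bound for `|GL_s(q)|`. The resulting constants are sharper than the stated ones. -/

lemma orthogonal_sup_eq (U W : Submodule F V) :
    B.orthogonal (U ⊔ W) = B.orthogonal U ⊓ B.orthogonal W := by
  refine le_antisymm (le_inf (orthogonal_le le_sup_left) (orthogonal_le le_sup_right)) ?_
  rintro x ⟨hU, hW⟩ y hy
  obtain ⟨a, ha, b, hb, rfl⟩ := Submodule.mem_sup.1 hy
  have h1 : B a x = 0 := hU a ha
  have h2 : B b x = 0 := hW b hb
  change B _ _ = 0
  rw [map_add, LinearMap.add_apply, h1, h2, add_zero]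

lemma le_orthogonal_sup_span (hB : B.IsAlt) {U : Submodule F V} (hU : U ≤ B.orthogonal U) {v : V}
    (hv : v ∈ B.orthogonal U) : U ⊔ F ∙ v ≤ B.orthogonal (U ⊔ F ∙ v) := by
  have hvv : B v v = 0 := hB v
  have h1 (u : V) (hu : u ∈ U) : B u v = 0 := hv u hu
  have h2 (u : V) (hu : u ∈ U) : B v u = 0 := hB.isRefl _ _ (h1 u hu)
  intro x hx y hy
  obtain ⟨a, ha, b, hb, rfl⟩ := Submodule.mem_sup.1 hx
  obtain ⟨c, hc, d, hd, rfl⟩ := Submodule.mem_sup.1 hy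
  obtain ⟨s, rfl⟩ := Submodule.mem_span_singleton.1 hb
  obtain ⟨t, rfl⟩ := Submodule.mem_span_singleton.1 hd
  have h3 : B c a = 0 := hU ha c hc
  change B _ _ = 0
  simp [h3, h1 c hc, h2 a ha, hvv]

lemma orthogonal_map_of_isometry {g : V ≃ₗ[F] V} (hg : ∀ x y, B (g x) (g y) = B x y)
    (L : Submodule F V) :
    B.orthogonal (L.map (g : V →ₗ[F] V)) = (B.orthogonal L).map (g : V →ₗ[F] V) := by
  ext x
  constructor
  · intro hx
    refine ⟨g.symm x, fun y hy => ?_, g.apply_symm_apply x⟩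
    rw [← hg, g.apply_symm_apply]
    exact hx _ (Submodule.mem_map_of_mem hy)
  · rintro ⟨y, hy, rfl⟩ _ ⟨z, hz, rfl⟩
    exact (hg z y).trans (hy z hz)

variable [FiniteDimensional F V]

/-- A pair of vectors with nonzero pairing is related by a symplectic transvection. -/
lemma exists_transvection (hB : B.IsAlt) (hnd : B.Nondegenerate) {u v : V} (huv : B u v ≠ 0) :
    ∃ g : V ≃ₗ[F] V, (∀ x y, B (g x) (g y) = B x y) ∧ g u = v ∧
      ∀ x, B x u = 0 → B x v = 0 → g x = x := by
  -- The transvection along `v - u`, scaled so that `u` goes to `v`, using `B u (v - u) = B u v`.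
  set g₀ : V →ₗ[F] V := LinearMap.id + ((B u v)⁻¹ • B.flip (v - u)).smulRight (v - u) with hg₀
  have hg (x : V) : g₀ x = x + ((B u v)⁻¹ * B x (v - u)) • (v - u) := by simp [hg₀]
  have hiso (x y : V) : B (g₀ x) (g₀ y) = B x y := by
    have h1 : B (v - u) (v - u) = 0 := hB _
    have h2 : B (v - u) y = - B y (v - u) := by rw [hB.neg_eq]
    rw [hg, hg]
    generalize v - u = a at *
    simp only [map_add, map_smul, LinearMap.add_apply, LinearMap.smul_apply, smul_eq_mul, h1, h2]
    ring
  have hinj : Function.Injective g₀ := by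
    rw [← LinearMap.ker_eq_bot, LinearMap.ker_eq_bot']
    intro x hx
    apply hnd.1
    intro y
    rw [← hiso, hx]
    simp
  refine ⟨LinearEquiv.ofInjectiveEndo g₀ hinj, hiso, ?_, fun x hxu hxv => ?_⟩
  · change g₀ u = v
    have h1 : B u u = 0 := hB _
    rw [hg, map_sub, h1, sub_zero, inv_mul_cancel₀ huv]
    simp
  · change g₀ x = x
    rw [hg, map_sub, hxu, hxv]
    simp

/-- The pointwise stabilizer of a subspace `U` in the symplectic group acts transitively on the
vectors orthogonal to `U` but not in `U`. -/
lemma exists_isometry_fixing (hB : B.IsAlt) (hnd : B.Nondegenerate) {U : Submodule F V} {u v : V}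
    (hu : u ∈ B.orthogonal U) (hu' : u ∉ U) (hv : v ∈ B.orthogonal U) (hv' : v ∉ U) :
    ∃ g : V ≃ₗ[F] V, (∀ x y, B (g x) (g y) = B x y) ∧ g u = v ∧ ∀ x ∈ U, g x = x := by
  have key {w : V} (hw : w ∉ U) : ∃ z ∈ B.orthogonal U, B z w ≠ 0 := by
    by_contra! h
    exact hw (by rw [← orthogonal_orthogonal hnd hB.isRefl U]; exact h)
  have step {a b : V} (ha : a ∈ B.orthogonal U) (hb : b ∈ B.orthogonal U) (hab : B a b ≠ 0) :
      ∃ g : V ≃ₗ[F] V, (∀ x y, B (g x) (g y) = B x y) ∧ g a = b ∧ ∀ x ∈ U, g x = x := by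
    obtain ⟨g, h1, h2, h3⟩ := exists_transvection hB hnd hab
    exact ⟨g, h1, h2, fun x hx => h3 x (ha x hx) (hb x hx)⟩
  -- `B u v` may vanish, so two transvections through an intermediate `w` are used. If neither `z₁`
  -- nor `z₂` pairs nontrivially with both vectors, their sum does.
  obtain ⟨w, hw, huw, hwv⟩ : ∃ w ∈ B.orthogonal U, B u w ≠ 0 ∧ B w v ≠ 0 := by
    obtain ⟨z₁, hz₁, h₁⟩ := key hu'
    obtain ⟨z₂, hz₂, h₂⟩ := key hv'
    have h₁' : B u z₁ ≠ 0 := fun h => h₁ (hB.isRefl _ _ h)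
    by_cases c₁ : B z₁ v = 0
    · by_cases c₂ : B u z₂ = 0
      · refine ⟨z₁ + z₂, add_mem hz₁ hz₂, ?_, ?_⟩
        · rwa [map_add, c₂, add_zero]
        · rwa [map_add, LinearMap.add_apply, c₁, zero_add]
      · exact ⟨z₂, hz₂, c₂, h₂⟩
    · exact ⟨z₁, hz₁, h₁', c₁⟩
  obtain ⟨g, hg, hgu, hgU⟩ := step hu hw huw
  obtain ⟨k, hk, hkw, hkU⟩ := step hw hv hwv
  refine ⟨g.trans k, fun x y => by simp [hk, hg], by simp [hgu, hkw], fun x hx => ?_⟩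
  simp [hgU x hx, hkU x hx]

lemma finrank_sup_span {U : Submodule F V} {v : V} (hv : v ∉ U) :
    finrank F (U ⊔ F ∙ v : Submodule F V) = finrank F U + 1 := by
  have hv0 : v ≠ 0 := fun h => hv (h ▸ U.zero_mem)
  have h := Submodule.finrank_sup_add_finrank_inf_eq U (F ∙ v)
  have hd : U ⊓ F ∙ v = ⊥ := (Submodule.disjoint_span_singleton' hv0).2 hv |>.eq_bot
  rw [hd, finrank_bot, finrank_span_singleton hv0] at h
  omega

/-- If `W` is nondegenerate then the orthogonal complement within `W` of a subspace of `W` has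
complementary dimension. -/
lemma finrank_inf_orthogonal (hB : B.IsAlt) (hnd : B.Nondegenerate) {U W : Submodule F V}
    (hUW : U ≤ W) (hW : Disjoint W (B.orthogonal W)) :
    finrank F (W ⊓ B.orthogonal U : Submodule F V) + finrank F U = finrank F W := by
  have h1 : W ⊓ B.orthogonal U = B.orthogonal (B.orthogonal W ⊔ U) := by
    rw [orthogonal_sup_eq, orthogonal_orthogonal hnd hB.isRefl]
  have h2 := Submodule.finrank_sup_add_finrank_inf_eq (B.orthogonal W) U
  have h3 : B.orthogonal W ⊓ U = ⊥ := (hW.symm.mono_right hUW).eq_bot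
  rw [h3, finrank_bot, finrank_orthogonal hnd] at h2
  rw [h1, finrank_orthogonal hnd]
  have := Submodule.finrank_le (B.orthogonal W ⊔ U)
  have := Submodule.finrank_le W
  omega

lemma two_mul_finrank_lagrangian (hnd : B.Nondegenerate) {L : Submodule F V}
    (hL : B.orthogonal L = L) : 2 * finrank F L = finrank F V := by
  have h := finrank_orthogonal hnd L
  rw [hL] at h
  have := Submodule.finrank_le L
  omega

/-- The dimensions of the intersections of a Lagrangian with a subspace and with its orthogonal
complement determine each other. -/
lemma finrank_lagrangian_inf_orthogonal (hnd : B.Nondegenerate)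
    {L W : Submodule F V} (hL : B.orthogonal L = L) :
    2 * finrank F (L ⊓ B.orthogonal W : Submodule F V) + 2 * finrank F W =
      finrank F V + 2 * finrank F (L ⊓ W : Submodule F V) := by
  have h1 : L ⊓ B.orthogonal W = B.orthogonal (L ⊔ W) := by rw [orthogonal_sup_eq, hL]
  have h2 := Submodule.finrank_sup_add_finrank_inf_eq L W
  have h3 := two_mul_finrank_lagrangian hnd hL
  rw [h1, finrank_orthogonal hnd]
  have := Submodule.finrank_le (L ⊔ W)
  omega

end Symplectic

/-! ### Double counting of Lagrangians and vectors. -/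

section Counting

open Module LinearMap.BilinForm Finset
open scoped Classical

variable {F V : Type*} [Field F] [AddCommGroup V] [Module F V] [Fintype V]
  {B : LinearMap.BilinForm F V}

variable (B) in
/-- The finite set of Lagrangian subspaces containing a given subspace. -/
noncomputable def lagrangiansAbove (U : Submodule F V) : Finset (Submodule F V) :=
  (Set.toFinite {L : Submodule F V | B.orthogonal L = L ∧ U ≤ L}).toFinset

@[simp] lemma mem_lagrangiansAbove {U L : Submodule F V} :
    L ∈ lagrangiansAbove B U ↔ B.orthogonal L = L ∧ U ≤ L := by
  simp [lagrangiansAbove]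

lemma card_lagrangiansAbove_map_le {g : V ≃ₗ[F] V} (hg : ∀ x y, B (g x) (g y) = B x y)
    (U : Submodule F V) :
    #(lagrangiansAbove B U) ≤ #(lagrangiansAbove B (U.map (g : V →ₗ[F] V))) := by
  refine card_le_card_of_injOn (fun L => L.map (g : V →ₗ[F] V)) (fun L hL => ?_)
    (Submodule.map_injective_of_injective g.injective).injOn
  simp only [mem_coe, mem_lagrangiansAbove] at hL ⊢
  exact ⟨by rw [orthogonal_map_of_isometry hg, hL.1], Submodule.map_mono hL.2⟩

/-- An isometry fixing `U` pointwise and moving `u` to `v` carries one family into the other. By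
symmetry in `u` and `v` the two counts are equal. -/
lemma card_lagrangiansAbove_sup_span_le (hB : B.IsAlt) (hnd : B.Nondegenerate)
    {U : Submodule F V} {u v : V}
    (hu : u ∈ B.orthogonal U) (hu' : u ∉ U) (hv : v ∈ B.orthogonal U) (hv' : v ∉ U) :
    #(lagrangiansAbove B (U ⊔ F ∙ u)) ≤ #(lagrangiansAbove B (U ⊔ F ∙ v)) := by
  obtain ⟨g, hg, hgu, hgU⟩ := exists_isometry_fixing hB hnd hu hu' hv hv'
  have h : (U ⊔ F ∙ u).map (g : V →ₗ[F] V) = U ⊔ F ∙ v := by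
    rw [Submodule.map_sup, Submodule.map_span, Set.image_singleton]
    congr 1
    · ext x
      constructor
      · rintro ⟨y, hy, rfl⟩
        simpa [hgU y hy] using hy
      · exact fun hx => ⟨x, hx, hgU x hx⟩
    · simp [hgu]
  exact h ▸ card_lagrangiansAbove_map_le hg _

variable [Fintype F]

lemma card_filter_mem_sdiff {S U : Submodule F V} (h : U ≤ S) :
    #{v : V | v ∈ S ∧ v ∉ U} =
      Fintype.card F ^ finrank F S - Fintype.card F ^ finrank F U := by
  have hc (T : Submodule F V) : #{v : V | v ∈ T} = Fintype.card F ^ finrank F T := by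
    rw [← Module.card_eq_pow_finrank, Fintype.card_subtype]
  rw [← hc, ← hc, ← card_sdiff_of_subset (monotone_filter_right _ fun v _ hv => h hv)]
  congr 1
  ext v
  simp

/-- Double counting of pairs `(L, v)` with `L` a Lagrangian above `U` and `v ∈ (L ∩ W) \ U`. -/
lemma sum_lagrangiansAbove_mul (f : Submodule F V → ℕ) {U W : Submodule F V} (hUW : U ≤ W) :
    ∑ L ∈ lagrangiansAbove B U,
      (Fintype.card F ^ finrank F (L ⊓ W : Submodule F V) - Fintype.card F ^ finrank F U) * f L =
    ∑ v : V with v ∈ W ⊓ B.orthogonal U ∧ v ∉ U, ∑ L ∈ lagrangiansAbove B (U ⊔ F ∙ v), f L := by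
  have h1 (L) (hL : L ∈ lagrangiansAbove B U) :
      (Fintype.card F ^ finrank F (L ⊓ W : Submodule F V) - Fintype.card F ^ finrank F U) * f L =
      ∑ v : V with v ∈ L ⊓ W ∧ v ∉ U, f L := by
    rw [← card_filter_mem_sdiff (le_inf (mem_lagrangiansAbove.1 hL).2 hUW), sum_const, smul_eq_mul]
  rw [sum_congr rfl h1]
  refine sum_comm' fun L v => ?_
  simp only [mem_lagrangiansAbove, mem_filter, mem_univ, true_and, Submodule.mem_inf, sup_le_iff,
    Submodule.span_singleton_le_iff_mem]
  constructor
  · rintro ⟨⟨hL, hUL⟩, ⟨hvL, hvW⟩, hvU⟩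
    exact ⟨⟨hL, hUL, hvL⟩, ⟨hvW, orthogonal_le hUL (hL.symm ▸ hvL)⟩, hvU⟩
  · rintro ⟨⟨hL, hUL, hvL⟩, ⟨hvW, -⟩, hvU⟩
    exact ⟨⟨hL, hUL⟩, ⟨hvL, hvW⟩, hvU⟩

/-- Enlarging an isotropic subspace by one dimension divides the number of Lagrangians above it by
at least `q ^ (n - k)`. -/
lemma card_lagrangiansAbove_sup_span (hB : B.IsAlt) (hnd : B.Nondegenerate) {n : ℕ}
    (hn : finrank F V = 2 * n) {U : Submodule F V} (hU : U ≤ B.orthogonal U) {v : V}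
    (hv : v ∈ B.orthogonal U) (hv' : v ∉ U) :
    Fintype.card F ^ (n - finrank F U) * #(lagrangiansAbove B (U ⊔ F ∙ v)) ≤
      #(lagrangiansAbove B U) := by
  have hk : finrank F U + 1 ≤ n := by
    have h1 := Submodule.finrank_mono (le_orthogonal_sup_span hB hU hv)
    rw [finrank_orthogonal hnd, finrank_sup_span hv'] at h1
    omega
  have hq : 1 < Fintype.card F := Fintype.one_lt_card
  have hO : finrank F (B.orthogonal U) = 2 * n - finrank F U := by rw [finrank_orthogonal hnd, hn]
  have h := sum_lagrangiansAbove_mul (B := B) (fun _ => 1) (le_top : U ≤ ⊤)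
  have hl : ∑ L ∈ lagrangiansAbove B U, (Fintype.card F ^ finrank F (L ⊓ ⊤ : Submodule F V) -
      Fintype.card F ^ finrank F U) * 1 = 
      #(lagrangiansAbove B U) * (Fintype.card F ^ n - Fintype.card F ^ finrank F U) := by
    rw [← smul_eq_mul, ← sum_const]
    refine sum_congr rfl fun L hL => ?_
    have := two_mul_finrank_lagrangian hnd (mem_lagrangiansAbove.1 hL).1
    rw [inf_top_eq, mul_one, show finrank F L = n by omega]
  have hr : #{x : V | x ∈ ⊤ ⊓ B.orthogonal U ∧ x ∉ U} * #(lagrangiansAbove B (U ⊔ F ∙ v)) ≤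
      ∑ x : V with x ∈ ⊤ ⊓ B.orthogonal U ∧ x ∉ U, ∑ L ∈ lagrangiansAbove B (U ⊔ F ∙ x), 1 := by
    rw [← smul_eq_mul, ← sum_const]
    refine sum_le_sum fun x hx => ?_
    simp only [mem_filter, mem_univ, true_and, top_inf_eq] at hx
    rw [← card_eq_sum_ones]
    exact card_lagrangiansAbove_sup_span_le hB hnd hv hv' hx.1 hx.2
  rw [top_inf_eq] at h hr
  rw [← h, hl, card_filter_mem_sdiff hU, hO] at hr
  generalize finrank F U = k at *
  obtain ⟨r, rfl⟩ := Nat.exists_eq_add_of_le (show k ≤ n by omega)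
  have hpos : 0 < Fintype.card F ^ (k + r) - Fintype.card F ^ k :=
    Nat.sub_pos_of_lt (Nat.pow_lt_pow_right hq (by omega))
  refine Nat.le_of_mul_le_mul_left ?_ hpos
  rw [mul_comm _ #(lagrangiansAbove B U)]
  refine le_trans ?_ hr
  rw [← mul_assoc]
  refine Nat.mul_le_mul_right _ ?_
  -- With `n = k + r` this reads `q^r (q^(k+r) - q^k) ≤ q^(k+2r) - q^k`.
  rw [show 2 * (k + r) - k = k + r + r by omega, show k + r - k = r by omega, Nat.sub_mul,
    ← pow_add, ← pow_add]
  exact Nat.sub_le_sub_left (Nat.pow_le_pow_right hq.le (by omega)) _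

/-- Bound for the number of pairs of a Lagrangian `L` above `U` and an `s`-tuple of vectors in
`L ∩ W` that is linearly independent modulo `U`. -/
lemma sum_prod_lagrangiansAbove_le (hB : B.IsAlt) (hnd : B.Nondegenerate) {n : ℕ}
    (hn : finrank F V = 2 * n) {W : Submodule F V} (hW : Disjoint W (B.orthogonal W)) (s : ℕ)
    {U : Submodule F V} (hU : U ≤ B.orthogonal U) (hUW : U ≤ W) :
    Fintype.card F ^ (s * n) * ∑ L ∈ lagrangiansAbove B U, ∏ i ∈ range s,
        (Fintype.card F ^ finrank F (L ⊓ W : Submodule F V) -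
          Fintype.card F ^ (finrank F U + i)) ≤
      Fintype.card F ^ (s * finrank F W) * #(lagrangiansAbove B U) := by
  induction s generalizing U with
  | zero => simp
  | succ s ih =>
    have hq : 0 < Fintype.card F := Fintype.card_pos
    -- The first vector of the tuple is split off and absorbed into `U`.
    have h1 := sum_lagrangiansAbove_mul (B := B) (fun L => ∏ i ∈ range s,
      (Fintype.card F ^ finrank F (L ⊓ W : Submodule F V) -
          Fintype.card F ^ (finrank F U + 1 + i))) hUW
    have h2 : ∀ L : Submodule F V, ∏ i ∈ range (s + 1),
        (Fintype.card F ^ finrank F (L ⊓ W : Submodule F V) -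
          Fintype.card F ^ (finrank F U + i)) =
        (Fintype.card F ^ finrank F (L ⊓ W : Submodule F V) - Fintype.card F ^ finrank F U) *
        ∏ i ∈ range s, (Fintype.card F ^ finrank F (L ⊓ W : Submodule F V) -
          Fintype.card F ^ (finrank F U + 1 + i)) := by
      intro L
      rw [prod_range_succ', mul_comm]
      simp [add_assoc, add_comm 1]
    simp only [h2, h1, mul_sum]
    have hfin := finrank_inf_orthogonal hB hnd hUW hW
    have hUn : finrank F U ≤ n := by
      have h1 := Submodule.finrank_mono hU
      rw [finrank_orthogonal hnd] at h1
      omega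
    have h3 : ∀ v ∈ ({v : V | v ∈ W ⊓ B.orthogonal U ∧ v ∉ U} : Finset V),
        ∑ L ∈ lagrangiansAbove B (U ⊔ F ∙ v), Fintype.card F ^ ((s + 1) * n) * ∏ i ∈ range s,
          (Fintype.card F ^ finrank F (L ⊓ W : Submodule F V) -
            Fintype.card F ^ (finrank F U + 1 + i)) ≤
        Fintype.card F ^ (s * finrank F W + finrank F U) * #(lagrangiansAbove B U) := by
      intro v hv
      simp only [mem_filter, mem_univ, true_and, Submodule.mem_inf] at hv
      obtain ⟨⟨hvW, hvO⟩, hvU⟩ := hv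
      have h4 := ih (le_orthogonal_sup_span hB hU hvO)
        (sup_le hUW ((Submodule.span_singleton_le_iff_mem _ _).2 hvW))
      have h5 := card_lagrangiansAbove_sup_span hB hnd hn hU hvO hvU
      rw [finrank_sup_span hvU] at h4
      rw [← mul_sum, show (s + 1) * n = finrank F U + (n - finrank F U) + s * n by
        rw [add_mul]; omega, pow_add, mul_assoc]
      calc _ ≤ Fintype.card F ^ (finrank F U + (n - finrank F U)) *
            (Fintype.card F ^ (s * finrank F W) * #(lagrangiansAbove B (U ⊔ F ∙ v))) :=
            Nat.mul_le_mul_left _ h4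
        _ = Fintype.card F ^ (s * finrank F W + finrank F U) *
            (Fintype.card F ^ (n - finrank F U) * #(lagrangiansAbove B (U ⊔ F ∙ v))) := by ring
        _ ≤ _ := Nat.mul_le_mul_left _ h5
    refine (sum_le_sum h3).trans ?_
    rw [sum_const, smul_eq_mul, card_filter_mem_sdiff (le_inf hUW hU), ← mul_assoc]
    refine Nat.mul_le_mul_right _ ?_
    calc _ ≤ Fintype.card F ^ finrank F (W ⊓ B.orthogonal U : Submodule F V) *
          Fintype.card F ^ (s * finrank F W + finrank F U) :=
          Nat.mul_le_mul_right _ (Nat.sub_le _ _)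
      _ = _ := by
        rw [← pow_add]
        congr 1
        rw [add_mul]
        omega

/-- Bound for the number of Lagrangians whose intersection with a nondegenerate subspace has
dimension at least `s`. -/
lemma card_lagrangians_finrank_inf_ge_mul_le (hB : B.IsAlt) (hnd : B.Nondegenerate) {n : ℕ}
    (hn : finrank F V = 2 * n) {W : Submodule F V} (hW : Disjoint W (B.orthogonal W)) (s : ℕ) :
    Fintype.card F ^ (s * n) *
      ({L : Submodule F V | B.orthogonal L = L ∧
        s ≤ finrank F (L ⊓ W : Submodule F V)}.ncard *
          ∏ i ∈ range s, (Fintype.card F ^ s - Fintype.card F ^ i)) ≤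
      Fintype.card F ^ (s * finrank F W) * {L : Submodule F V | B.orthogonal L = L}.ncard := by
  have h := sum_prod_lagrangiansAbove_le hB hnd hn hW s bot_le bot_le
  have hq : 0 < Fintype.card F := Fintype.card_pos
  have h0 : ((lagrangiansAbove B ⊥ : Finset (Submodule F V)) : Set (Submodule F V)) =
      {L : Submodule F V | B.orthogonal L = L} := by ext; simp
  rw [← h0, Set.ncard_coe_finset]
  refine le_trans (Nat.mul_le_mul_left _ ?_) h
  have h1 : {L : Submodule F V | B.orthogonal L = L ∧ s ≤ finrank F (L ⊓ W : Submodule F V)} =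
      ((lagrangiansAbove B ⊥).filter
        (fun L => s ≤ finrank F (L ⊓ W : Submodule F V)) : Finset (Submodule F V)) := by
    ext; simp
  rw [h1, Set.ncard_coe_finset, ← smul_eq_mul, ← sum_const]
  refine le_trans (sum_le_sum fun L hL => ?_) (sum_le_sum_of_subset (filter_subset _ _))
  refine prod_le_prod' fun i hi => ?_
  rw [finrank_bot, zero_add]
  exact Nat.sub_le_sub_right (Nat.pow_le_pow_right hq (mem_filter.1 hL).2) _

end Counting

/-! ### The standard symplectic space and its coordinate subspaces. -/

section StandardForm

open Module LinearMap.BilinForm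

variable {F : Type*} [Field F]

lemma sympForm_apply {n : ℕ} (v w : SympSpace F n) :
    sympForm F n v w = v.1 ⬝ᵥ w.2 - v.2 ⬝ᵥ w.1 := rfl

lemma sympForm_isAlt (n : ℕ) : (sympForm F n).IsAlt := fun v => by
  rw [sympForm_apply, dotProduct_comm, sub_self]

lemma sympForm_nondegenerate (n : ℕ) : (sympForm F n).Nondegenerate := by
  have hB := (sympForm_isAlt (F := F) n).isRefl
  refine (LinearMap.IsRefl.nondegenerate_iff_separatingLeft hB).2 ?_
  intro v hv
  ext i
  · simpa [sympForm_apply] using hv (0, Pi.single i 1)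
  · simpa [sympForm_apply] using hv (Pi.single i 1, 0)

lemma mem_firstCoords {n m : ℕ} {v : Fin n → F} :
    v ∈ firstCoords F n m ↔ ∀ i : Fin n, m ≤ (i : ℕ) → v i = 0 := by
  constructor
  · intro hv i hi
    induction hv using Submodule.span_induction with
    | mem x hx =>
      obtain ⟨j, hj, rfl⟩ := hx
      exact Pi.single_eq_of_ne (by rintro rfl; omega) _
    | zero => rfl
    | add x y _ _ hx hy => rw [Pi.add_apply, hx, hy, add_zero]
    | smul c x _ hx => rw [Pi.smul_apply, hx, smul_zero]
  · intro h
    rw [pi_eq_sum_univ' v]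
    refine Submodule.sum_mem _ fun i _ => ?_
    by_cases hi : (i : ℕ) < m
    · refine Submodule.smul_mem _ _ (Submodule.subset_span ⟨i, hi, ?_⟩)
      ext k
      simp [Pi.single_apply, eq_comm]
    · rw [h i (not_lt.1 hi), zero_smul]
      exact Submodule.zero_mem _

lemma finrank_firstCoords {n m : ℕ} (h : m ≤ n) : finrank F (firstCoords F n m) = m := by
  have h1 : firstCoords F n m = Submodule.span F
      (Set.range fun i : Fin m => (Pi.single (Fin.castLE h i) 1 : Fin n → F)) := by
    refine congrArg _ (Set.ext fun v => ⟨?_, ?_⟩)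
    · rintro ⟨i, hi, rfl⟩
      exact ⟨⟨i, hi⟩, rfl⟩
    · rintro ⟨i, rfl⟩
      exact ⟨_, i.2, rfl⟩
  rw [h1, finrank_span_eq_card, Fintype.card_fin]
  have h2 := (Pi.basisFun F (Fin n)).linearIndependent.comp _ (Fin.castLE_injective h)
  simpa [Function.comp_def] using h2

lemma finrank_coordSubspace {n m : ℕ} (h : m ≤ n) : finrank F (coordSubspace F n m) = 2 * m := by
  let e : coordSubspace F n m ≃ₗ[F] firstCoords F n m × firstCoords F n m :=
    { toFun := fun x => (⟨x.1.1, x.2.1⟩, ⟨x.1.2, x.2.2⟩)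
      invFun := fun y => ⟨(y.1, y.2), y.1.2, y.2.2⟩
      map_add' := fun _ _ => rfl
      map_smul' := fun _ _ => rfl
      left_inv := fun _ => rfl
      right_inv := fun _ => rfl }
  rw [e.finrank_eq, finrank_prod, finrank_firstCoords h, two_mul]

lemma disjoint_coordSubspace_orthogonal (n m : ℕ) :
    Disjoint (coordSubspace F n m) ((sympForm F n).orthogonal (coordSubspace F n m)) := by
  rw [Submodule.disjoint_def]
  rintro ⟨x, y⟩ ⟨hx, hy⟩ ho
  have hs {i : Fin n} (hi : (i : ℕ) < m) : Pi.single i 1 ∈ firstCoords F n m :=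
    Submodule.subset_span ⟨i, hi, rfl⟩
  ext i
  · by_cases hi : (i : ℕ) < m
    · have := ho (0, Pi.single i 1) ⟨Submodule.zero_mem _, hs hi⟩
      simpa [sympForm_apply] using this
    · exact mem_firstCoords.1 hx i (not_lt.1 hi)
  · by_cases hi : (i : ℕ) < m
    · have := ho (Pi.single i 1, 0) ⟨hs hi, Submodule.zero_mem _⟩
      simpa [sympForm_apply] using this
    · exact mem_firstCoords.1 hy i (not_lt.1 hi)

lemma finrank_sympSpace (n : ℕ) : finrank F (SympSpace F n) = 2 * n := by
  rw [finrank_prod, finrank_fin_fun, two_mul]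

lemma prod_top_bot_mem_lagrangians (n : ℕ) :
    (⊤ : Submodule F (Fin n → F)).prod ⊥ ∈ lagrangians F n := by
  ext ⟨x, y⟩
  constructor
  · intro h
    refine ⟨trivial, ?_⟩
    ext i
    have := h (Pi.single i 1, 0) ⟨trivial, rfl⟩
    simpa [sympForm_apply] using this
  · rintro ⟨-, hy⟩ ⟨z, w⟩ ⟨-, hw⟩
    obtain rfl : y = 0 := hy
    obtain rfl : w = 0 := hw
    simp [sympForm_apply]

lemma numLagrangians_pos [Finite F] (n : ℕ) : 0 < numLagrangians F n :=
  (Set.ncard_pos (Set.toFinite _)).2 ⟨_, prod_top_bot_mem_lagrangians n⟩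

/-- A Lagrangian is either in general position with respect to `E^m ⊕ F^m`, or meets the
nondegenerate subspace `W` of dimension `2 * min m (n - m)` nontrivially, where `W` is
`E^m ⊕ F^m` or its orthogonal complement. -/
lemma exists_numGeneric_add [Finite F] {n m : ℕ} (h : m ≤ n) :
    ∃ W : Submodule F (SympSpace F n), Disjoint W ((sympForm F n).orthogonal W) ∧
      (finrank F W : ℤ) = n - |(n : ℤ) - 2 * m| ∧
      numGeneric F n m + {L : Submodule F (SympSpace F n) | (sympForm F n).orthogonal L = L ∧
        1 ≤ finrank F (L ⊓ W : Submodule F (SympSpace F n))}.ncard = numLagrangians F n := by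
  have split (p r : Submodule F (SympSpace F n) → Prop)
      (hpr : ∀ L ∈ lagrangians F n, ¬ p L ↔ r L) :
      {L ∈ lagrangians F n | p L}.ncard +
        {L : Submodule F (SympSpace F n) | (sympForm F n).orthogonal L = L ∧ r L}.ncard =
        numLagrangians F n := by
    rw [numLagrangians, ← Set.ncard_inter_add_ncard_sdiff_eq_ncard (lagrangians F n) {L | p L}
      (Set.toFinite _)]
    congr 2
    ext L
    exact and_congr_right fun hL => (hpr L hL).symm
  have hW := disjoint_coordSubspace_orthogonal (F := F) n m
  have hd := finrank_coordSubspace (F := F) h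
  by_cases hmn : 2 * m ≤ n
  · refine ⟨coordSubspace F n m, hW, ?_, ?_⟩
    · rw [hd, abs_of_nonneg (by omega)]
      push_cast
      ring
    · rw [numGeneric, if_pos hmn]
      refine split _ _ fun L _ => ?_
      rw [Nat.one_le_iff_ne_zero, ne_eq, Submodule.finrank_eq_zero]
  · have hnd := sympForm_nondegenerate (F := F) n
    -- For `2m > n`, the intersection of `L` with the complement has dimension smaller by `2m - n`
    -- than that with `E^m ⊕ F^m`, so general position means meeting the complement trivially.
    refine ⟨(sympForm F n).orthogonal (coordSubspace F n m), ?_, ?_, ?_⟩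
    · rw [orthogonal_orthogonal hnd (sympForm_isAlt n).isRefl]
      exact hW.symm
    · rw [finrank_orthogonal hnd, hd, finrank_sympSpace, abs_of_nonpos (by omega)]
      omega
    · rw [numGeneric, if_neg hmn]
      refine split _ _ fun L hL => ?_
      have h1 := finrank_lagrangian_inf_orthogonal hnd (W := coordSubspace F n m) hL
      rw [hd, finrank_sympSpace] at h1
      omega

end StandardForm

/-! ### Real estimates for the order of `GL_s(q)` and for the constants. -/

section Estimates

open Finset

/-- Bernoulli's inequality with exponent `x ^ i ≤ 1` gives `(1 - x) ^ (x ^ i) ≤ 1 - x ^ (i + 1)`;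
the exponents sum to at most `1 / (1 - x)`. -/
lemma pow_one_sub_inv_le_prod {x : ℝ} (hx : 0 < x) (hx1 : x < 1) (s : ℕ) :
    Real.exp (Real.log (1 - x) / (1 - x)) ≤ ∏ i ∈ range s, (1 - x ^ (i + 1)) := by
  have h1x : 0 < 1 - x := by linarith
  have hfac (i : ℕ) : Real.exp (Real.log (1 - x) * x ^ i) ≤ 1 - x ^ (i + 1) := by
    have := rpow_one_add_le_one_add_mul_self (s := -x) (by linarith) (pow_nonneg hx.le i)
      (pow_le_one₀ hx.le hx1.le)
    rw [← sub_eq_add_neg, Real.rpow_def_of_pos h1x] at this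
    exact this.trans_eq (by ring)
  calc Real.exp (Real.log (1 - x) / (1 - x))
      ≤ Real.exp (∑ i ∈ range s, Real.log (1 - x) * x ^ i) := by
        refine Real.exp_le_exp.2 ?_
        rw [← mul_sum, div_eq_mul_inv]
        refine mul_le_mul_of_nonpos_left ?_ (Real.log_nonpos h1x.le (by linarith))
        rw [← tsum_geometric_of_lt_one hx.le hx1]
        exact (summable_geometric_of_lt_one hx.le hx1).sum_le_tsum _
          fun i _ => pow_nonneg hx.le i
    _ = ∏ i ∈ range s, Real.exp (Real.log (1 - x) * x ^ i) := Real.exp_sum _ _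
    _ ≤ _ := prod_le_prod (fun i _ => (Real.exp_pos _).le) fun i _ => hfac i

/-- The product is `|GL_s(q)| = q ^ (s ^ 2) ∏ (1 - q ^ (-i))` over `1 ≤ i ≤ s`, so the previous
bound applies with `x = 1 / q`. -/
lemma exp_mul_pow_le_prod_sub {q : ℕ} (hq : 1 < q) (s : ℕ) :
    Real.exp (-((q : ℝ) / (q - 1) * |Real.log (1 - (q : ℝ)⁻¹)|)) * (q : ℝ) ^ (s ^ 2) ≤
      ((∏ i ∈ range s, (q ^ s - q ^ i) : ℕ) : ℝ) := by
  have hq' : (1 : ℝ) < q := by exact_mod_cast hq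
  have hq0 : (0 : ℝ) < q := by linarith
  have hx1 : (q : ℝ)⁻¹ < 1 := inv_lt_one_of_one_lt₀ hq'
  have h := pow_one_sub_inv_le_prod (inv_pos.2 hq0) hx1 s
  have he : -((q : ℝ) / (q - 1) * |Real.log (1 - (q : ℝ)⁻¹)|) =
      Real.log (1 - (q : ℝ)⁻¹) / (1 - (q : ℝ)⁻¹) := by
    have h2 : (q : ℝ) - 1 ≠ 0 := by linarith
    have h3 : 1 - (q : ℝ)⁻¹ = (q - 1) / q := by field_simp
    rw [abs_of_nonpos (Real.log_nonpos (by linarith) (by linarith [inv_pos.2 hq0]))]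
    rw [show Real.log (1 - (q : ℝ)⁻¹) / (1 - (q : ℝ)⁻¹) =
      Real.log (1 - (q : ℝ)⁻¹) * (1 - (q : ℝ)⁻¹)⁻¹ from div_eq_mul_inv _ _]
    nth_rw 3 [h3]
    rw [inv_div]
    ring
  rw [he]
  refine (mul_le_mul_of_nonneg_right h (by positivity)).trans_eq ?_
  rw [Nat.cast_prod, ← prod_range_reflect, sq, pow_mul, ← card_range s, ← prod_const, card_range,
    ← prod_mul_distrib]
  refine prod_congr rfl fun i hi => ?_
  have hi := mem_range.1 hi
  rw [Nat.cast_sub (Nat.pow_le_pow_right (by omega) (by omega)), show s - 1 - i + 1 = s - i by omega,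
    inv_pow, sub_mul, one_mul]
  push_cast
  congr 1
  rw [pow_sub₀ _ hq0.ne' hi.le]
  field_simp

/-- The left side is `q⁻¹ / (1 - q⁻¹)`; the logarithm is pure slack. -/
lemma inv_sub_one_le {q : ℝ} (hq : 1 < q) :
    (q - 1)⁻¹ ≤ (q⁻¹ + |Real.log (1 - q⁻¹)|) / (1 - q⁻¹) := by
  have h : 1 - q⁻¹ = (q - 1) * q⁻¹ := by field_simp
  have h0 : 0 < 1 - q⁻¹ := by linarith [inv_lt_one_of_one_lt₀ hq]
  rw [le_div_iff₀ h0]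
  have h1 : (q - 1)⁻¹ * (1 - q⁻¹) = q⁻¹ := by
    rw [h, inv_mul_cancel_left₀ (by linarith)]
  linarith [abs_nonneg (Real.log (1 - q⁻¹))]

lemma one_le_div_sub {q : ℝ} (hq : 2 ≤ q) : 1 ≤ (q ^ 2 - 1) ^ 2 / ((q ^ 2 - 1) ^ 2 - q) := by
  rw [one_le_div (by nlinarith [mul_nonneg (sub_nonneg.2 hq) (sub_nonneg.2 hq)])]
  linarith

end Estimates

/-! ### The two proportions of Lagrangians. -/

section Main

open Module Finset

variable {F : Type*} [Field F] [Fintype F]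

lemma one_sub_numGeneric_div_le {n m : ℕ} (h : m ≤ n) :
    0 ≤ 1 - (numGeneric F n m : ℝ) / numLagrangians F n ∧
    1 - (numGeneric F n m : ℝ) / numLagrangians F n ≤
      ((Fintype.card F : ℝ) - 1)⁻¹ * (Fintype.card F : ℝ) ^ (-|(n : ℤ) - 2 * m|) := by
  obtain ⟨W, hW, hd, hsum⟩ := exists_numGeneric_add (F := F) h
  have hb := card_lagrangians_finrank_inf_ge_mul_le (sympForm_isAlt n) (sympForm_nondegenerate n)
    (finrank_sympSpace n) hW 1
  have hL : (0 : ℝ) < numLagrangians F n := by exact_mod_cast numLagrangians_pos n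
  have hq : 1 < Fintype.card F := Fintype.one_lt_card
  change _ ≤ _ * numLagrangians F n at hb
  set a := {L : Submodule F (SympSpace F n) | (sympForm F n).orthogonal L = L ∧
        1 ≤ finrank F (L ⊓ W : Submodule F (SympSpace F n))}.ncard
  have hq' : (0 : ℝ) < (Fintype.card F : ℝ) - 1 := by
    rw [sub_pos]
    exact_mod_cast hq
  have hq0 : (0 : ℝ) < Fintype.card F := by linarith
  have ha : 1 - (numGeneric F n m : ℝ) / numLagrangians F n = a / numLagrangians F n := by
    rw [one_sub_div hL.ne', ← hsum]
    push_cast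
    ring
  rw [ha]
  refine ⟨by positivity, ?_⟩
  rw [div_le_iff₀ hL, show -|(n : ℤ) - 2 * m| = (finrank F W : ℤ) - n by omega,
    zpow_sub₀ hq0.ne', zpow_natCast, zpow_natCast]
  have hb' : (Fintype.card F : ℝ) ^ n * (a * (Fintype.card F - 1)) ≤
      (Fintype.card F : ℝ) ^ finrank F W * numLagrangians F n := by
    have := (Nat.cast_le (α := ℝ)).2 hb
    simpa [Nat.cast_sub hq.le] using this
  rw [inv_mul_eq_div, div_div, div_mul_eq_mul_div, le_div_iff₀ (by positivity)]
  linarith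

lemma numInterGe_div_le {n m : ℕ} (h : 2 * m ≤ n) {t : ℝ} (ht : 0 ≤ t) :
    (numInterGe F n m t : ℝ) / numLagrangians F n ≤
      Real.exp ((Fintype.card F : ℝ) / (Fintype.card F - 1) *
        |Real.log (1 - (Fintype.card F : ℝ)⁻¹)|) * (Fintype.card F : ℝ) ^ (-t ^ 2) := by
  have hb := card_lagrangians_finrank_inf_ge_mul_le (sympForm_isAlt n) (sympForm_nondegenerate n)
    (finrank_sympSpace n) (disjoint_coordSubspace_orthogonal (F := F) n m) ⌈t⌉₊
  have hL : (0 : ℝ) < numLagrangians F n := by exact_mod_cast numLagrangians_pos n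
  have hq : 1 < Fintype.card F := Fintype.one_lt_card
  have hset : {L : Submodule F (SympSpace F n) | (sympForm F n).orthogonal L = L ∧
      ⌈t⌉₊ ≤ finrank F (L ⊓ coordSubspace F n m : Submodule F (SympSpace F n))}.ncard =
      numInterGe F n m t := by
    simp only [Nat.ceil_le]
    rfl
  change _ ≤ _ * numLagrangians F n at hb
  rw [hset, finrank_coordSubspace (by omega)] at hb
  -- Since `dim W = 2m ≤ n`, the powers of `q` on both sides can be cancelled.
  replace hb := Nat.le_of_mul_le_mul_left (hb.trans (Nat.mul_le_mul_right _
    (Nat.pow_le_pow_right hq.le (Nat.mul_le_mul_left ⌈t⌉₊ h)))) (by positivity)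
  have hp := exp_mul_pow_le_prod_sub hq ⌈t⌉₊
  have hq' : (1 : ℝ) < Fintype.card F := by exact_mod_cast hq
  have hq0 : (0 : ℝ) < Fintype.card F := by linarith
  have ht2 : (Fintype.card F : ℝ) ^ (t ^ 2) ≤ (Fintype.card F : ℝ) ^ (⌈t⌉₊ ^ 2) := by
    rw [← Real.rpow_natCast _ (⌈t⌉₊ ^ 2)]
    refine Real.rpow_le_rpow_of_exponent_le hq'.le ?_
    push_cast
    exact pow_le_pow_left₀ ht (Nat.le_ceil t) 2
  rw [div_le_iff₀ hL, Real.rpow_neg hq0.le]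
  generalize (Fintype.card F : ℝ) / (Fintype.card F - 1) *
    |Real.log (1 - (Fintype.card F : ℝ)⁻¹)| = c at *
  have hr : 0 < (Fintype.card F : ℝ) ^ (t ^ 2) := Real.rpow_pos_of_pos hq0 _
  have hb' := (Nat.cast_le (α := ℝ)).2 hb
  rw [Nat.cast_mul] at hb'
  rw [← div_eq_mul_inv, div_mul_eq_mul_div, le_div_iff₀ hr]
  have h1 : (numInterGe F n m t : ℝ) * (Real.exp (-c) * (Fintype.card F : ℝ) ^ (t ^ 2)) ≤
      numLagrangians F n :=
    (mul_le_mul_of_nonneg_left ((mul_le_mul_of_nonneg_left ht2 (Real.exp_pos _).le).trans hp)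
      (Nat.cast_nonneg _)).trans hb'
  calc _ = Real.exp c * ((numInterGe F n m t : ℝ) *
        (Real.exp (-c) * (Fintype.card F : ℝ) ^ (t ^ 2))) := by
        rw [Real.exp_neg]
        field_simp
    _ ≤ _ := mul_le_mul_of_nonneg_left h1 (Real.exp_pos _).le

end Main

theorem mainTheorem3 (F : Type*) [Field F] [Fintype F] (q : ℕ) (hq : Fintype.card F = q)
    (l j : ℕ) (hjl : j ≤ l) :
    (2 * j ≠ l → ∀ N : ℕ,
      0 ≤ 1 - (numGeneric F (N * l) (N * j) : ℝ) / (numLagrangians F (N * l) : ℝ) ∧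
      1 - (numGeneric F (N * l) (N * j) : ℝ) / (numLagrangians F (N * l) : ℝ) ≤
        ((q : ℝ)⁻¹ + |Real.log (1 - (q : ℝ)⁻¹)|) / (1 - (q : ℝ)⁻¹) *
          (q : ℝ) ^ (-(|(l : ℤ) - 2 * (j : ℤ)| * (N : ℤ)))) ∧
    (2 * j ≤ l → ∀ ε : ℝ, 0 < ε → ∀ N : ℕ,
      (numInterGe F (N * l) (N * j) ((N : ℝ) * ε) : ℝ) / (numLagrangians F (N * l) : ℝ) ≤
        Real.exp (2 * (q : ℝ) / ((q : ℝ) - 1) * |Real.log (1 - (q : ℝ)⁻¹)|) *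
          (((q : ℝ) ^ 2 - 1) ^ 2 / (((q : ℝ) ^ 2 - 1) ^ 2 - (q : ℝ))) *
          (q : ℝ) ^ (-((N : ℝ) ^ 2 * ε ^ 2))) := by
  subst hq
  have hq : (2 : ℝ) ≤ Fintype.card F := by exact_mod_cast Fintype.one_lt_card (α := F)
  have hq0 : (0 : ℝ) < Fintype.card F := by linarith
  refine ⟨fun _ N => ?_, fun hjl ε hε N => ?_⟩
  · have h := one_sub_numGeneric_div_le (F := F) (Nat.mul_le_mul_left N hjl)
    refine ⟨h.1, h.2.trans ?_⟩
    have he : |((N * l : ℕ) : ℤ) - 2 * ((N * j : ℕ) : ℤ)| = |(l : ℤ) - 2 * (j : ℤ)| * (N : ℤ) := by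
      have hN : |(N : ℤ)| = N := abs_of_nonneg (Int.natCast_nonneg N)
      have he : ((N * l : ℕ) : ℤ) - 2 * ((N * j : ℕ) : ℤ) = ((l : ℤ) - 2 * j) * N := by
        push_cast
        ring
      rw [he, abs_mul, hN]
    rw [he]
    exact mul_le_mul_of_nonneg_right (inv_sub_one_le (by linarith)) (zpow_pos hq0 _).le
  · have h := numInterGe_div_le (F := F) (n := N * l) (m := N * j) (t := N * ε)
      (by rw [mul_left_comm]; exact Nat.mul_le_mul_left N hjl) (by positivity)
    rw [mul_pow] at h
    refine h.trans (mul_le_mul_of_nonneg_right ?_ (Real.rpow_pos_of_pos hq0 _).le)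
    -- The rational factor is at least 1 and the exponent is doubled, so both only weaken the bound.
    refine le_trans ?_ (le_mul_of_one_le_right (Real.exp_pos _).le (one_le_div_sub hq))
    refine Real.exp_le_exp.2 (mul_le_mul_of_nonneg_right ?_ (abs_nonneg _))
    exact div_le_div_of_nonneg_right (by linarith) (by linarith)
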